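/- Let $m\in\mathbb N$, let $\Omega\subset\mathbb R^m$ be a bounded domain (non-empty, open, connected), let $\vec F=(F_1,\dots,F_m)\in L^1(\Omega;\mathbb R^m)$ be a vector field whose components lie in $W^1(\Omega)$ (that is, each $F_J$ has locally integrable first weak partial derivatives in $\Omega$), and let $H\in L^\infty(\Omega)$. For $w\in W^{1,1}(\Omega)$ put $$\mathcal F_H(w)=\int_\Omega \bigl(|\nabla w+\vec F|+Hw\bigr)\,dx ,$$ where $\nabla w$ is the weak gradient and $|\cdot|$ the Euclidean norm, and let $h_{IJ}=\partial_IF_J-\partial_JF_I$ ($1\le I,J\le m$, weak derivatives). A function $w\in W^{1,1}(\Omega)$ is called a minimizer for $\mathcal F_H$ in $W^{1,1}(\Omega)$ if $\mathcal F_H(w)\le\mathcal F_H(w+\varphi)$ for all $\varphi\in W^{1,1}_0(\Omega)$. Here $W^{k,1}_0(\Omega)$ is the closure of $C_c^\infty(\Omega)$ in $W^{k,1}(\Omega)$. Let $u,v\in W^{2,1}(\Omega)$ be two minimizers for $\mathcal F_H$ in $W^{1,1}(\Omega)$ with $u-v\in W^{2,1}_0(\Omega)$. Suppose that for some constant $C>0$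 we have $|\nabla u+\vec F|\ge C$ and $|\nabla v+\vec F|\ge C$ a.e. in $\Omega$, and that $3\le\operatorname{rank}(h_{IJ})\le m$ a.e. in $\Omega$. Then $u=v$ a.e. in $\Omega$. -/

import Mathlib

open MeasureTheory TopologicalSpace
open scoped Distributions ENNReal

noncomputable section

namespace PArea

/-- Euclidean space `ℝ^m`. -/
abbrev Euc (m : ℕ) : Type := EuclideanSpace ℝ (Fin m)

variable {m : ℕ}

/-- The classical partial derivative `∂φ/∂x_i`. -/
def partialDeriv (i : Fin m) (φ : Euc m → ℝ) (x : Euc m) : ℝ :=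
  fderiv ℝ φ x (EuclideanSpace.single i 1)

/-- `g` is a weak partial derivative `∂f/∂x_i` in the open set `Ω`: both functions are locally
integrable in `Ω` and `∫_Ω f ∂_i φ = - ∫_Ω g φ` for every `φ ∈ C_c^∞(Ω)`. -/
def HasWeakPartial (Ω : Opens (Euc m)) (i : Fin m) (f g : Euc m → ℝ) : Prop :=
  LocallyIntegrableOn f (Ω : Set (Euc m)) volume ∧
  LocallyIntegrableOn g (Ω : Set (Euc m)) volume ∧
  ∀ φ : 𝓓(Ω, ℝ),
    ∫ x in (Ω : Set (Euc m)), f x * partialDeriv i φ x =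
      - ∫ x in (Ω : Set (Euc m)), g x * φ x

/-- `W^1(Ω)`: the weakly differentiable functions, i.e. the locally integrable functions
all of whose first weak partial derivatives exist as locally integrable functions. -/
def MemW1 (Ω : Opens (Euc m)) (f : Euc m → ℝ) : Prop :=
  LocallyIntegrableOn f (Ω : Set (Euc m)) volume ∧
  ∀ i : Fin m, ∃ g : Euc m → ℝ, HasWeakPartial Ω i f g

open Classical in
/-- A representative of the weak partial derivative `∂_i f` in `Ω`
(and `0` if there is no weak derivative). It is unique up to null sets, see
`HasWeakPartial.ae_eq_weakPartial`. -/
def weakPartial (Ω : Opens (Euc m)) (i : Fin m) (f : Euc m → ℝ) : Euc m → ℝ :=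
  if h : ∃ g : Euc m → ℝ, HasWeakPartial Ω i f g then h.choose else 0

theorem hasWeakPartial_weakPartial {Ω : Opens (Euc m)} {i : Fin m} {f : Euc m → ℝ}
    (h : ∃ g : Euc m → ℝ, HasWeakPartial Ω i f g) :
    HasWeakPartial Ω i f (weakPartial Ω i f) := by
  unfold weakPartial
  rw [dif_pos h]
  exact h.choose_spec

/-- Multiplication of a locally integrable function by a test function is integrable. -/
theorem integrable_mul_test {Ω : Opens (Euc m)} {g : Euc m → ℝ}
    (hg : LocallyIntegrableOn g (Ω : Set (Euc m)) volume) (φ : 𝓓(Ω, ℝ)) :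
    Integrable (fun x => g x * φ x) volume := by
  have hK : IsCompact (tsupport φ) := φ.hasCompactSupport
  have h1 : IntegrableOn g (tsupport φ) volume :=
    hg.integrableOn_compact_subset φ.tsupport_subset hK
  have h2 : IntegrableOn (fun x => g x * φ x) (tsupport φ) volume :=
    h1.mul_continuousOn φ.continuous.continuousOn hK
  refine (integrableOn_iff_integrable_of_support_subset ?_).mp h2
  intro x hx
  by_contra hn
  exact hx (by simp [image_eq_zero_of_notMem_tsupport hn])

/-- Weak derivatives are unique up to null sets. -/
theorem HasWeakPartial.ae_eq_weakPartial {Ω : Opens (Euc m)} {i : Fin m} {f g : Euc m → ℝ}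
    (h : HasWeakPartial Ω i f g) :
    g =ᵐ[volume.restrict (Ω : Set (Euc m))] weakPartial Ω i f := by
  have hex : ∃ g' : Euc m → ℝ, HasWeakPartial Ω i f g' := ⟨g, h⟩
  obtain ⟨-, hg, hgi⟩ := h
  obtain ⟨-, hw, hwi⟩ := hasWeakPartial_weakPartial hex
  have key := Ω.isOpen.ae_eq_zero_of_integral_contDiff_smul_eq_zero (μ := volume) (hg.sub hw) (by
    intro φ h1 h2 h3
    let ψ : 𝓓(Ω, ℝ) := ⟨φ, h1, h2, h3⟩
    have e := (hgi ψ).symm.trans (hwi ψ)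
    have a := integrable_mul_test hg ψ
    have b := integrable_mul_test hw ψ
    have z : ∀ k : Euc m → ℝ, ∫ x in (Ω : Set (Euc m)), k x * ψ x = ∫ x, k x * ψ x := by
      intro k
      apply setIntegral_eq_integral_of_forall_compl_eq_zero
      intro x hx
      have : φ x = 0 := image_eq_zero_of_notMem_tsupport fun hh => hx (h3 hh)
      show k x * φ x = 0
      rw [this, mul_zero]
    rw [z, z] at e
    have c : ∫ x, (g x * ψ x - weakPartial Ω i f x * ψ x) = 0 := by
      rw [integral_sub a b]; linarith
    rw [← c]
    congr 1
    ext x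
    show φ x * (g x - weakPartial Ω i f x) = g x * φ x - weakPartial Ω i f x * φ x
    ring)
  rw [Filter.EventuallyEq, ae_restrict_iff' Ω.isOpen.measurableSet]
  filter_upwards [key] with x hx hxΩ
  exact sub_eq_zero.mp (hx hxΩ)

/-- The weak gradient `∇f`. -/
def weakGrad (Ω : Opens (Euc m)) (f : Euc m → ℝ) (x : Euc m) : Euc m :=
  WithLp.toLp 2 (fun i => weakPartial Ω i f x)

/-- `W^{1,1}(Ω)`. -/
def MemW11 (Ω : Opens (Euc m)) (f : Euc m → ℝ) : Prop :=
  MemW1 Ω f ∧ IntegrableOn f (Ω : Set (Euc m)) volume ∧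
  ∀ i : Fin m, IntegrableOn (weakPartial Ω i f) (Ω : Set (Euc m)) volume

/-- `W^{2,1}(Ω)`: weak derivatives up to order two exist and are in `L^1(Ω)`. -/
def MemW21 (Ω : Opens (Euc m)) (f : Euc m → ℝ) : Prop :=
  MemW11 Ω f ∧ ∀ i : Fin m, MemW11 Ω (weakPartial Ω i f)

/-- The norm of `W^{1,1}(Ω)`. -/
def normW11 (Ω : Opens (Euc m)) (f : Euc m → ℝ) : ℝ :=
  (∫ x in (Ω : Set (Euc m)), |f x|) +
    ∑ i : Fin m, ∫ x in (Ω : Set (Euc m)), |weakPartial Ω i f x|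

/-- The norm of `W^{2,1}(Ω)`. -/
def normW21 (Ω : Opens (Euc m)) (f : Euc m → ℝ) : ℝ :=
  normW11 Ω f + ∑ i : Fin m, ∑ j : Fin m,
    ∫ x in (Ω : Set (Euc m)), |weakPartial Ω j (weakPartial Ω i f) x|

/-- `W_0^{1,1}(Ω)`: the closure of `C_c^∞(Ω)` in `W^{1,1}(Ω)`. -/
def MemW011 (Ω : Opens (Euc m)) (f : Euc m → ℝ) : Prop :=
  MemW11 Ω f ∧ ∀ ε : ℝ, 0 < ε → ∃ φ : 𝓓(Ω, ℝ), normW11 Ω (fun x => f x - φ x) < ε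

/-- `W_0^{2,1}(Ω)`: the closure of `C_c^∞(Ω)` in `W^{2,1}(Ω)`. -/
def MemW021 (Ω : Opens (Euc m)) (f : Euc m → ℝ) : Prop :=
  MemW21 Ω f ∧ ∀ ε : ℝ, 0 < ε → ∃ φ : 𝓓(Ω, ℝ), normW21 Ω (fun x => f x - φ x) < ε

/-- The generalized `p`-area `𝓕_H(u) = ∫_Ω |∇u + F| + H u`. -/
def pArea (Ω : Opens (Euc m)) (F : Euc m → Euc m) (H u : Euc m → ℝ) : ℝ :=
  ∫ x in (Ω : Set (Euc m)), (‖weakGrad Ω u x + F x‖ + H x * u x)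

/-- `u` is a minimizer for `𝓕_H` in `W^{1,1}(Ω)`: `u ∈ W^{1,1}(Ω)` and
`𝓕_H(u) ≤ 𝓕_H(u + φ)` for all `φ ∈ W_0^{1,1}(Ω)`. -/
def IsMinimizer (Ω : Opens (Euc m)) (F : Euc m → Euc m) (H u : Euc m → ℝ) : Prop :=
  MemW11 Ω u ∧ ∀ φ : Euc m → ℝ, MemW011 Ω φ →
    pArea Ω F H u ≤ pArea Ω F H (fun x => u x + φ x)

/-- The skew-symmetric matrix `h_{IJ} = ∂_I F_J - ∂_J F_I` (weak derivatives). -/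
def curlMatrix (Ω : Opens (Euc m)) (F : Euc m → Euc m) (x : Euc m) :
    Matrix (Fin m) (Fin m) ℝ :=
  Matrix.of fun I J =>
    weakPartial Ω I (fun y => F y J) x - weakPartial Ω J (fun y => F y I) x

end PArea

end

/-! Write `θ = ∇u + F`, `θ' = ∇v + F`. The midpoint of `u` and `v` is an admissible competitor for
both minimizers, so convexity of the functional forces equality a.e. in the triangle inequality for
`θ` and `θ'` (`IsMinimizer.ae_sameRay`). Both fields are nonzero, hence they have the same unit
direction `N`.

It remains to compare the lengths `p = |θ|` and `q = |θ'|`. Hessians are symmetric, so both fields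
have curl `h` (`ae_curlMatrix_eq`). Differentiating `N = θ / p = θ' / q` gives two formulas for `∂_I
N_J`; eliminating it yields `q ∂_I θ_J - p ∂_I θ'_J = c_I N_J` for some vector `c`, and
antisymmetrizing, `(q - p) h_IJ = c_I N_J - c_J N_I`. The right side has rank at most two, so rank
at least three forces `p = q` (`ae_norm_eq_of_curl_eq`). Hence `∇u = ∇v` a.e., and the Poincaré
inequality on `W_0^{1,1}` concludes (`MemW011.ae_eq_zero`).

The analytic work is the weak derivative of `N`. Since `y / |y|` is singular at the origin, the
bound `|θ| ≥ C` is used to replace it by a globally `C^1` map with bounded derivative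
(`exists_contDiff_normalize`), for which `hasWeakPartial_comp` proves the chain rule by
mollification. -/

noncomputable section

namespace PArea

open Filter Topology

section

variable {m : ℕ}

/-! ### Calculus of weak derivatives -/

/-- The partial derivative of a test function, as a test function. -/
def testPartial {Ω : Opens (Euc m)} (i : Fin m) (φ : 𝓓(Ω, ℝ)) : 𝓓(Ω, ℝ) where
  toFun := partialDeriv i φ
  contDiff' := (φ.contDiff.fderiv_right (m := (⊤ : ℕ∞)) (by simp)).clm_apply contDiff_const
  hasCompactSupport' := φ.hasCompactSupport.fderiv_apply (𝕜 := ℝ) _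
  tsupport_subset' := (tsupport_fderiv_apply_subset ℝ _).trans φ.tsupport_subset

@[simp] theorem testPartial_apply {Ω : Opens (Euc m)} (i : Fin m) (φ : 𝓓(Ω, ℝ)) (x : Euc m) :
    testPartial i φ x = partialDeriv i φ x := rfl

theorem integrable_mul_partialDeriv {Ω : Opens (Euc m)} {g : Euc m → ℝ}
    (hg : LocallyIntegrableOn g (Ω : Set (Euc m)) volume) (i : Fin m) (φ : 𝓓(Ω, ℝ)) :
    Integrable (fun x => g x * partialDeriv i φ x) volume :=
  integrable_mul_test hg (testPartial i φ)

theorem setIntegral_mul_test {Ω : Opens (Euc m)} (g : Euc m → ℝ) (φ : 𝓓(Ω, ℝ)) :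
    ∫ x in (Ω : Set (Euc m)), g x * φ x = ∫ x, g x * φ x := by
  apply setIntegral_eq_integral_of_forall_compl_eq_zero
  intro x hx
  rw [image_eq_zero_of_notMem_tsupport fun h => hx (φ.tsupport_subset h), mul_zero]

theorem setIntegral_mul_partialDeriv {Ω : Opens (Euc m)} (g : Euc m → ℝ) (i : Fin m)
    (φ : 𝓓(Ω, ℝ)) :
    ∫ x in (Ω : Set (Euc m)), g x * partialDeriv i φ x = ∫ x, g x * partialDeriv i φ x :=
  setIntegral_mul_test g (testPartial i φ)

theorem locallyIntegrableOn_congr {Ω : Opens (Euc m)} {f g : Euc m → ℝ}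
    (h : f =ᵐ[volume.restrict (Ω : Set (Euc m))] g)
    (hf : LocallyIntegrableOn f (Ω : Set (Euc m)) volume) :
    LocallyIntegrableOn g (Ω : Set (Euc m)) volume := by
  rw [locallyIntegrableOn_iff (Ω.isOpen.isLocallyClosed)] at hf ⊢
  intro k hk hkc
  exact (hf k hk hkc).congr (ae_restrict_of_ae_restrict_of_subset hk h)

variable {Ω : Opens (Euc m)} {i : Fin m} {f g f' g' : Euc m → ℝ}

theorem HasWeakPartial.congr (h : HasWeakPartial Ω i f f')
    (hf : f =ᵐ[volume.restrict (Ω : Set (Euc m))] g)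
    (hf' : f' =ᵐ[volume.restrict (Ω : Set (Euc m))] g') : HasWeakPartial Ω i g g' := by
  refine ⟨locallyIntegrableOn_congr hf h.1, locallyIntegrableOn_congr hf' h.2.1, fun φ => ?_⟩
  have e1 : ∫ x in (Ω : Set (Euc m)), f x * partialDeriv i φ x =
      ∫ x in (Ω : Set (Euc m)), g x * partialDeriv i φ x :=
    integral_congr_ae (by filter_upwards [hf] with x hx; rw [hx])
  have e2 : ∫ x in (Ω : Set (Euc m)), f' x * φ x = ∫ x in (Ω : Set (Euc m)), g' x * φ x :=
    integral_congr_ae (by filter_upwards [hf'] with x hx; rw [hx])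
  rw [← e1, ← e2, h.2.2 φ]

theorem HasWeakPartial.add (h : HasWeakPartial Ω i f f') (k : HasWeakPartial Ω i g g') :
    HasWeakPartial Ω i (fun x => f x + g x) (fun x => f' x + g' x) := by
  refine ⟨h.1.add k.1, h.2.1.add k.2.1, fun φ => ?_⟩
  simp only [add_mul]
  rw [integral_add (integrable_mul_partialDeriv h.1 i φ).integrableOn
      (integrable_mul_partialDeriv k.1 i φ).integrableOn,
    integral_add (integrable_mul_test h.2.1 φ).integrableOn
      (integrable_mul_test k.2.1 φ).integrableOn, h.2.2 φ, k.2.2 φ]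
  ring

theorem HasWeakPartial.const_mul (h : HasWeakPartial Ω i f f') (c : ℝ) :
    HasWeakPartial Ω i (fun x => c * f x) (fun x => c * f' x) := by
  refine ⟨h.1.smul c, h.2.1.smul c, fun φ => ?_⟩
  simp only [mul_assoc]
  rw [integral_const_mul, integral_const_mul, h.2.2 φ]
  ring

theorem HasWeakPartial.sub (h : HasWeakPartial Ω i f f') (k : HasWeakPartial Ω i g g') :
    HasWeakPartial Ω i (fun x => f x - g x) (fun x => f' x - g' x) := by
  simpa [sub_eq_add_neg] using h.add (k.const_mul (-1))

theorem HasWeakPartial.ae_unique (h : HasWeakPartial Ω i f f') (k : HasWeakPartial Ω i f g') :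
    f' =ᵐ[volume.restrict (Ω : Set (Euc m))] g' :=
  h.ae_eq_weakPartial.trans k.ae_eq_weakPartial.symm

theorem MemW1.hasWeakPartial (h : MemW1 Ω f) (i : Fin m) :
    HasWeakPartial Ω i f (weakPartial Ω i f) :=
  hasWeakPartial_weakPartial (h.2 i)

theorem MemW11.hasWeakPartial (h : MemW11 Ω f) (i : Fin m) :
    HasWeakPartial Ω i f (weakPartial Ω i f) :=
  h.1.hasWeakPartial i

theorem partialDeriv_comm {φ : Euc m → ℝ} (hφ : ContDiff ℝ 2 φ) (i j : Fin m) (x : Euc m) :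
    partialDeriv i (partialDeriv j φ) x = partialDeriv j (partialDeriv i φ) x := by
  have hd : DifferentiableAt ℝ (fderiv ℝ φ) x :=
    ((hφ.fderiv_right (m := 1) (by norm_num)).differentiable (by norm_num)) x
  have hs : IsSymmSndFDerivAt ℝ φ x := hφ.contDiffAt.isSymmSndFDerivAt (by simp)
  have key : ∀ a b : Fin m, partialDeriv a (partialDeriv b φ) x =
      fderiv ℝ (fderiv ℝ φ) x (EuclideanSpace.single a 1) (EuclideanSpace.single b 1) := by
    intro a b
    show fderiv ℝ (fun y => fderiv ℝ φ y (EuclideanSpace.single b 1)) x _ = _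
    rw [fderiv_clm_apply hd (differentiableAt_const _)]
    simp
  rw [key, key]
  exact hs.eq _ _

/-- Second weak derivatives commute. -/
theorem HasWeakPartial.comm {i j : Fin m} {fi fj g : Euc m → ℝ} (hi : HasWeakPartial Ω i f fi)
    (hj : HasWeakPartial Ω j f fj) (hji : HasWeakPartial Ω i fj g) :
    HasWeakPartial Ω j fi g := by
  refine ⟨hi.2.1, hji.2.1, fun φ => ?_⟩
  -- Integrating `f` against the mixed derivative of `φ`, in either order, shows that `fi` against
  -- `∂_j φ` equals `fj` against `∂_i φ`.
  have h1 := hi.2.2 (testPartial j φ)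
  have h2 := hj.2.2 (testPartial i φ)
  have h3 := hji.2.2 φ
  have hc : ∀ x, partialDeriv i (testPartial j φ) x = partialDeriv j (testPartial i φ) x :=
    partialDeriv_comm (φ.contDiff.of_le (WithTop.coe_le_coe.2 (le_top : (2 : ℕ∞) ≤ ⊤))) i j
  simp only [hc, testPartial_apply] at h1 h2
  linarith

theorem hasWeakPartial_test (φ : 𝓓(Ω, ℝ)) (i : Fin m) :
    HasWeakPartial Ω i φ (partialDeriv i φ) := by
  have hint : ∀ ψ : 𝓓(Ω, ℝ), Integrable ψ volume := fun ψ =>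
    ψ.continuous.integrable_of_hasCompactSupport ψ.hasCompactSupport
  have hl : ∀ ψ : 𝓓(Ω, ℝ), LocallyIntegrableOn ψ (Ω : Set (Euc m)) volume := fun ψ =>
    (hint ψ).locallyIntegrable.locallyIntegrableOn _
  refine ⟨hl φ, hl (testPartial i φ), fun ψ => ?_⟩
  rw [setIntegral_mul_partialDeriv, setIntegral_mul_test]
  refine integral_mul_fderiv_eq_neg_fderiv_mul_of_integrable
    (integrable_mul_test (hl (testPartial i φ)) ψ) (integrable_mul_partialDeriv (hl φ) i ψ)
    (integrable_mul_test (hl φ) ψ) (fun x _ => ?_) (fun x _ => ?_)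
  · exact (φ.contDiff.differentiable (by simp)) x
  · exact (ψ.contDiff.differentiable (by simp)) x

theorem integrable_test (φ : 𝓓(Ω, ℝ)) : Integrable φ volume :=
  φ.continuous.integrable_of_hasCompactSupport φ.hasCompactSupport

/-- By uniqueness, integrability of any weak derivatives passes to the chosen representatives
`weakPartial`; closure properties of `W^{1,1}` then need only explicit derivatives. -/
theorem memW11_of_hasWeakPartial {G : Fin m → Euc m → ℝ}
    (hf : IntegrableOn f (Ω : Set (Euc m)) volume) (hw : ∀ i, HasWeakPartial Ω i f (G i))
    (hG : ∀ i, IntegrableOn (G i) (Ω : Set (Euc m)) volume) : MemW11 Ω f :=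
  ⟨⟨hf.locallyIntegrableOn, fun i => ⟨_, hw i⟩⟩, hf,
    fun i => (hG i).congr (hw i).ae_eq_weakPartial⟩

theorem memW11_test (φ : 𝓓(Ω, ℝ)) : MemW11 Ω φ :=
  memW11_of_hasWeakPartial (integrable_test φ).integrableOn (hasWeakPartial_test φ)
    fun i => (integrable_test (testPartial i φ)).integrableOn

theorem MemW11.add (hf : MemW11 Ω f) (hg : MemW11 Ω g) : MemW11 Ω (fun x => f x + g x) :=
  memW11_of_hasWeakPartial (hf.2.1.add hg.2.1)
    (fun i => (hf.hasWeakPartial i).add (hg.hasWeakPartial i))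
    fun i => (hf.2.2 i).add (hg.2.2 i)

theorem MemW11.sub (hf : MemW11 Ω f) (hg : MemW11 Ω g) : MemW11 Ω (fun x => f x - g x) :=
  memW11_of_hasWeakPartial (hf.2.1.sub hg.2.1)
    (fun i => (hf.hasWeakPartial i).sub (hg.hasWeakPartial i))
    fun i => (hf.2.2 i).sub (hg.2.2 i)

theorem MemW11.const_mul (hf : MemW11 Ω f) (c : ℝ) : MemW11 Ω (fun x => c * f x) :=
  memW11_of_hasWeakPartial (hf.2.1.const_mul c)
    (fun i => (hf.hasWeakPartial i).const_mul c) fun i => (hf.2.2 i).const_mul c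

theorem MemW11.normW11_const_mul (hf : MemW11 Ω f) (c : ℝ) :
    normW11 Ω (fun x => c * f x) = |c| * normW11 Ω f := by
  unfold normW11
  rw [mul_add, Finset.mul_sum]
  simp only [abs_mul, integral_const_mul]
  congr 1
  refine Finset.sum_congr rfl fun i _ => ?_
  rw [← integral_const_mul]
  refine integral_congr_ae ?_
  filter_upwards [((hf.hasWeakPartial i).const_mul c).ae_eq_weakPartial] with x hx
  rw [← hx, abs_mul]

theorem MemW011.const_mul (hf : MemW011 Ω f) (c : ℝ) : MemW011 Ω (fun x => c * f x) := by
  refine ⟨hf.1.const_mul c, fun ε hε => ?_⟩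
  -- The summand `1` covers `c = 0`.
  obtain ⟨φ, hφ⟩ := hf.2 (ε / (|c| + 1)) (by positivity)
  refine ⟨c • φ, ?_⟩
  have e : (fun x => c * f x - (c • φ : 𝓓(Ω, ℝ)) x) = fun x => c * (f x - φ x) := by
    ext x
    change c * f x - c * φ x = _
    ring
  rw [e, (hf.1.sub (memW11_test φ)).normW11_const_mul]
  have h0 : 0 ≤ |c| := abs_nonneg c
  calc |c| * normW11 Ω (fun x => f x - φ x) ≤ |c| * (ε / (|c| + 1)) := by gcongr
    _ < (|c| + 1) * (ε / (|c| + 1)) := by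
        gcongr
        linarith
    _ = ε := by field_simp

theorem MemW021.memW011 (hf : MemW021 Ω f) : MemW011 Ω f := by
  refine ⟨hf.1.1, fun ε hε => ?_⟩
  obtain ⟨φ, hφ⟩ := hf.2 ε hε
  refine ⟨φ, lt_of_le_of_lt ?_ hφ⟩
  unfold normW21
  exact le_add_of_nonneg_right (Finset.sum_nonneg fun i _ => Finset.sum_nonneg fun j _ =>
    integral_nonneg fun x => abs_nonneg _)

end

section

variable {m : ℕ}

/-! ### Mollification -/

/-- A version of dominated convergence with convergent dominating functions. -/
theorem tendsto_integral_abs_sub_of_le {α : Type*} [MeasurableSpace α] {μ : Measure α}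
    {g : α → ℝ} {gn hn : ℕ → α → ℝ} (hg : Integrable g μ) (hgn : ∀ n, Integrable (gn n) μ)
    (hhn : ∀ n, Integrable (hn n) μ) (hle : ∀ n, ∀ᵐ x ∂μ, |gn n x| ≤ hn n x)
    (hgl : ∀ᵐ x ∂μ, Tendsto (fun n => gn n x) atTop (𝓝 (g x)))
    (hhl : ∀ᵐ x ∂μ, Tendsto (fun n => hn n x) atTop (𝓝 |g x|))
    (hint : ∀ n, ∫ x, hn n x ∂μ = ∫ x, |g x| ∂μ) :
    Tendsto (fun n => ∫ x, |gn n x - g x| ∂μ) atTop (𝓝 0) := by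
  set I := ∫ x, |g x| ∂μ with hI
  -- These functions are nonnegative and converge a.e. to `2|g|`; Fatou's lemma applied to them
  -- bounds the upper limit of the `L^1` distances by zero.
  set D : ℕ → α → ℝ := fun n x => hn n x + |g x| - |gn n x - g x| with hD
  have hDi : ∀ n, Integrable (D n) μ := fun n =>
    ((hhn n).add hg.abs).sub ((hgn n).sub hg).abs
  have hD0 : ∀ n, 0 ≤ᵐ[μ] D n := fun n => by
    filter_upwards [hle n] with x hx
    have := abs_sub (gn n x) (g x)
    simp only [hD, Pi.zero_apply]
    linarith
  have hDint : ∀ n, ∫ x, D n x ∂μ = 2 * I - ∫ x, |gn n x - g x| ∂μ := fun n => by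
    have e1 : ∫ x, D n x ∂μ = (∫ x, (hn n x + |g x|) ∂μ) - ∫ x, |gn n x - g x| ∂μ :=
      integral_sub ((hhn n).add hg.abs) ((hgn n).sub hg).abs
    have e2 : ∫ x, (hn n x + |g x|) ∂μ = (∫ x, hn n x ∂μ) + I := integral_add (hhn n) hg.abs
    rw [e1, e2, hint n]
    ring
  have hlim : ∀ᵐ x ∂μ, liminf (fun n => ENNReal.ofReal (D n x)) atTop =
      ENNReal.ofReal (2 * |g x|) := by
    filter_upwards [hgl, hhl] with x h1 h2
    have h3 : Tendsto (fun n => D n x) atTop (𝓝 (2 * |g x|)) := by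
      have := (h2.add_const |g x|).sub ((h1.sub_const (g x)).abs)
      simpa [hD, two_mul] using this
    exact (ENNReal.tendsto_ofReal h3).liminf_eq
  have hfatou := lintegral_liminf_le' (μ := μ) (u := atTop) (f := fun n x => ENNReal.ofReal (D n x))
    (fun n => (hDi n).aemeasurable.ennreal_ofReal)
  rw [lintegral_congr_ae hlim, ← ofReal_integral_eq_lintegral_ofReal (hg.abs.const_mul 2)
    (Eventually.of_forall fun x => by positivity), integral_const_mul, ← hI] at hfatou
  simp_rw [← ofReal_integral_eq_lintegral_ofReal (hDi _) (hD0 _), hDint] at hfatou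
  have hI0 : 0 ≤ I := integral_nonneg fun x => abs_nonneg _
  have hpos : ∀ n, 0 ≤ ∫ x, |gn n x - g x| ∂μ := fun n => integral_nonneg fun x => abs_nonneg _
  rcases hI0.eq_or_lt with h0 | h0
  -- Treated apart because the strict inequality between `ENNReal.ofReal` values used below requires
  -- `0 < 2 * I`.
  · have hz : ∀ n, ∫ x, |gn n x - g x| ∂μ = 0 := fun n => by
      have := integral_nonneg_of_ae (hD0 n)
      rw [hDint n] at this
      have := hpos n
      linarith
    simp [hz]
  · rw [Metric.tendsto_atTop']
    intro ε hε
    have hlt : ENNReal.ofReal (2 * I - ε) < ENNReal.ofReal (2 * I) :=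
      (ENNReal.ofReal_lt_ofReal_iff (by linarith)).2 (by linarith)
    have hev := eventually_lt_of_lt_liminf (hlt.trans_le hfatou)
    obtain ⟨N, hN⟩ := eventually_atTop.1 hev
    refine ⟨N, fun n hn => ?_⟩
    have := ENNReal.lt_ofReal_iff_toReal_lt (ENNReal.ofReal_ne_top) |>.1 (hN n hn.le)
    rw [ENNReal.toReal_ofReal'] at this
    rw [Real.dist_eq, sub_zero, abs_of_nonneg (hpos n)]
    have := (le_max_left _ _).trans_lt this
    linarith

/-- A sequence of bump functions with supports shrinking to the origin. -/
def moll (m : ℕ) (n : ℕ) : ContDiffBump (0 : Euc m) where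
  rIn := 1 / (n + 1)
  rOut := 2 / (n + 1)
  rIn_pos := by positivity
  rIn_lt_rOut := by gcongr; norm_num

theorem tendsto_moll_rOut (m : ℕ) : Tendsto (fun n => (moll m n).rOut) atTop (𝓝 0) := by
  have := (tendsto_one_div_add_atTop_nhds_zero_nat (𝕜 := ℝ)).const_mul 2
  simpa [moll, div_eq_mul_inv] using this

/-- The mollification of `g`. -/
def mollify (n : ℕ) (g : Euc m → ℝ) : Euc m → ℝ :=
  convolution ((moll m n).normed volume) g (ContinuousLinearMap.lsmul ℝ ℝ) volume

theorem mollify_apply (n : ℕ) (g : Euc m → ℝ) (x : Euc m) :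
    mollify n g x = ∫ t, g t * (moll m n).normed volume (x - t) := by
  unfold mollify
  rw [convolution_eq_swap]
  simp [mul_comm]

theorem contDiff_mollify (n : ℕ) {g : Euc m → ℝ} (hg : LocallyIntegrable g volume) :
    ContDiff ℝ (⊤ : ℕ∞) (mollify n g) :=
  (moll m n).hasCompactSupport_normed.contDiff_convolution_left _ (moll m n).contDiff_normed hg

theorem ae_tendsto_mollify {g : Euc m → ℝ} (hg : LocallyIntegrable g volume) :
    ∀ᵐ x, Tendsto (fun n => mollify n g x) atTop (𝓝 (g x)) :=
  -- `2` is the fixed ratio of the outer to the inner radius of the bumps.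
  ContDiffBump.ae_convolution_tendsto_right_of_locallyIntegrable (K := 2)
    (tendsto_moll_rOut m) (Eventually.of_forall fun n => by simp [moll]; ring_nf; rfl) hg

theorem integrable_mollify (n : ℕ) {g : Euc m → ℝ} (hg : Integrable g volume) :
    Integrable (mollify n g) volume :=
  (moll m n).integrable_normed.integrable_convolution _ hg

theorem integral_mollify (n : ℕ) {g : Euc m → ℝ} (hg : Integrable g volume) :
    ∫ x, mollify n g x = ∫ x, g x := by
  unfold mollify
  rw [integral_convolution _ (moll m n).integrable_normed hg]
  simp [(moll m n).integral_normed]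

theorem abs_mollify_le (n : ℕ) (g : Euc m → ℝ) (x : Euc m) :
    |mollify n g x| ≤ mollify n (fun y => |g y|) x := by
  rw [mollify_apply, mollify_apply]
  refine (abs_integral_le_integral_abs).trans_eq (integral_congr_ae (Eventually.of_forall ?_))
  intro t
  simp only [abs_mul, abs_of_nonneg ((moll m n).nonneg_normed _)]

/-- The mollifications of `|g|` serve as convergent dominating functions: mollification preserves
the integral, so theirs all equal that of `|g|`. -/
theorem tendsto_integral_abs_mollify_sub {g : Euc m → ℝ} (hg : Integrable g volume) :
    Tendsto (fun n => ∫ x, |mollify n g x - g x|) atTop (𝓝 0) :=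
  tendsto_integral_abs_sub_of_le hg (fun n => integrable_mollify n hg)
    (fun n => integrable_mollify n hg.abs)
    (fun n => Eventually.of_forall (abs_mollify_le n g))
    (ae_tendsto_mollify hg.locallyIntegrable) (ae_tendsto_mollify hg.abs.locallyIntegrable)
    fun n => integral_mollify n hg.abs

theorem partialDeriv_mollify (n : ℕ) (i : Fin m) {g : Euc m → ℝ}
    (hg : LocallyIntegrable g volume) (x : Euc m) :
    partialDeriv i (mollify n g) x =
      ∫ t, g t * partialDeriv i ((moll m n).normed volume) (x - t) := by
  have h := (moll m n).hasCompactSupport_normed.hasFDerivAt_convolution_left (μ := volume)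
    (ContinuousLinearMap.lsmul ℝ ℝ) ((moll m n).contDiff_normed (μ := volume) (n := 1)) hg x
  unfold partialDeriv mollify
  rw [h.fderiv, convolution_eq_swap, ContinuousLinearMap.integral_apply]
  · refine integral_congr_ae (Eventually.of_forall fun t => ?_)
    simp [ContinuousLinearMap.precompL_apply, mul_comm]
  · have hc : HasCompactSupport (fderiv ℝ ((moll m n).normed (volume : Measure (Euc m)))) :=
      ((moll m n).hasCompactSupport_normed (μ := volume)).fderiv (𝕜 := ℝ)
    have hcc : Continuous (fderiv ℝ ((moll m n).normed (volume : Measure (Euc m)))) :=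
      ((moll m n).contDiff_normed (μ := volume) (n := 1)).continuous_fderiv (by norm_num)
    have hex : ConvolutionExistsAt (fderiv ℝ ((moll m n).normed (volume : Measure (Euc m)))) g x
        ((ContinuousLinearMap.lsmul ℝ ℝ : ℝ →L[ℝ] ℝ →L[ℝ] ℝ).precompL (Euc m)) volume :=
      HasCompactSupport.convolutionExists_left _ hc hcc hg x
    exact hex.integrable_swap

/-- Mollification commutes with weak derivatives away from the boundary. -/
theorem HasWeakPartial.partialDeriv_mollify {Ω : Opens (Euc m)} {i : Fin m} {f f' : Euc m → ℝ}
    (h : HasWeakPartial Ω i f f') {K : Set (Euc m)} (hK : IsCompact K)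
    (hKΩ : K ⊆ (Ω : Set (Euc m))) {n : ℕ} {x : Euc m}
    (hx : Metric.closedBall x (moll m n).rOut ⊆ K) :
    partialDeriv i (mollify n (K.indicator f)) x = mollify n (K.indicator f') x := by
  have hint : ∀ {g : Euc m → ℝ}, LocallyIntegrableOn g (Ω : Set (Euc m)) volume →
      LocallyIntegrable (K.indicator g) volume := fun hg =>
    ((integrable_indicator_iff hK.measurableSet).2
      (hg.integrableOn_compact_subset hKΩ hK)).locallyIntegrable
  rw [PArea.partialDeriv_mollify n i (hint h.1), mollify_apply]
  set ρ := (moll m n).normed (volume : Measure (Euc m)) with hρ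
  have hsm : ContDiff ℝ (⊤ : ℕ∞) fun t => ρ (x - t) :=
    (moll m n).contDiff_normed.comp (contDiff_const.sub contDiff_id)
  have hsupp : tsupport (fun t => ρ (x - t)) ⊆ Metric.closedBall x (moll m n).rOut := by
    refine closure_minimal (fun t ht => ?_) Metric.isClosed_closedBall
    have : x - t ∈ Function.support ρ := ht
    rw [hρ, (moll m n).support_normed_eq, mem_ball_zero_iff] at this
    rw [Metric.mem_closedBall, dist_comm, dist_eq_norm]
    exact this.le
  -- The reflected kernel centred at `x` is a test function supported in `K`, so the cut-off by `K`
  -- is invisible to it. The sign from differentiating in `t` cancels the one in the definition of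
  -- weak derivative.
  let ψ : 𝓓(Ω, ℝ) := ⟨fun t => ρ (x - t), hsm,
    HasCompactSupport.of_support_subset_isCompact (isCompact_closedBall x _)
      (subset_closure.trans hsupp), hsupp.trans (hx.trans hKΩ)⟩
  have hψ : ∀ t, ψ t = ρ (x - t) := fun t => rfl
  have hdψ : ∀ t, partialDeriv i ψ t = -partialDeriv i ρ (x - t) := by
    intro t
    unfold partialDeriv
    have h1 : HasFDerivAt ρ (fderiv ℝ ρ (x - t)) (x - t) :=
      ((((moll m n).contDiff_normed (μ := volume) (n := 1)).differentiable (by norm_num)) _).hasFDerivAt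
    have h2 : HasFDerivAt (fun t => x - t) (-ContinuousLinearMap.id ℝ (Euc m)) t :=
      (hasFDerivAt_id t).const_sub x
    have h3 : HasFDerivAt ψ _ t := h1.comp t h2
    rw [h3.fderiv]
    simp
  have hin : ∀ (g : Euc m → ℝ) (η : 𝓓(Ω, ℝ)), tsupport η ⊆ K →
      ∀ t, K.indicator g t * η t = g t * η t := by
    intro g η hη t
    by_cases ht : t ∈ K
    · rw [Set.indicator_of_mem ht]
    · rw [image_eq_zero_of_notMem_tsupport fun h => ht (hη h), mul_zero, mul_zero]
  have hψK : tsupport ψ ⊆ K := hsupp.trans hx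
  have hdψK : tsupport (testPartial i ψ) ⊆ K := (tsupport_fderiv_apply_subset ℝ _).trans hψK
  have e := h.2.2 ψ
  rw [setIntegral_mul_partialDeriv, setIntegral_mul_test] at e
  have e1 : ∫ t, K.indicator f t * partialDeriv i ρ (x - t) =
      - ∫ t, f t * partialDeriv i ψ t := by
    rw [← integral_neg]
    refine integral_congr_ae (Eventually.of_forall fun t => ?_)
    have := hin f (testPartial i ψ) hdψK t
    rw [testPartial_apply] at this
    simp only
    rw [← this, hdψ]
    ring
  have e2 : ∫ t, K.indicator f' t * ρ (x - t) = ∫ t, f' t * ψ t :=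
    integral_congr_ae (Eventually.of_forall fun t => hin f' ψ hψK t)
  rw [e1, e2, e, neg_neg]

end

section

variable {m : ℕ}

/-! ### The chain rule -/

/-- Split `qn * gn` as `qn * g + qn * (gn - g)`: dominated convergence handles the first term, the
bound `M` times the `L^1` distance the second. -/
theorem tendsto_integral_mul_of_bounded {α : Type*} [MeasurableSpace α] {μ : Measure α}
    {q : α → ℝ} {qn : ℕ → α → ℝ} {g : α → ℝ} {gn : ℕ → α → ℝ} {M : ℝ}
    (hqn : ∀ n, AEStronglyMeasurable (qn n) μ) (hM : ∀ n x, |qn n x| ≤ M)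
    (hq : ∀ᵐ x ∂μ, Tendsto (fun n => qn n x) atTop (𝓝 (q x)))
    (hg : Integrable g μ) (hgn : ∀ n, Integrable (gn n) μ)
    (hlim : Tendsto (fun n => ∫ x, |gn n x - g x| ∂μ) atTop (𝓝 0)) :
    Tendsto (fun n => ∫ x, qn n x * gn n x ∂μ) atTop (𝓝 (∫ x, q x * g x ∂μ)) := by
  have hb : ∀ {k : α → ℝ} (n : ℕ), Integrable k μ → Integrable (fun x => qn n x * k x) μ :=
    fun n hk => hk.bdd_mul (hqn n) (Eventually.of_forall (hM n))
  have h1 : Tendsto (fun n => ∫ x, qn n x * g x ∂μ) atTop (𝓝 (∫ x, q x * g x ∂μ)) := by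
    refine tendsto_integral_of_dominated_convergence (fun x => M * |g x|)
      (fun n => (hb n hg).aestronglyMeasurable) (hg.abs.const_mul M)
      (fun n => Eventually.of_forall fun x => ?_) ?_
    · rw [Real.norm_eq_abs, abs_mul]
      exact mul_le_mul_of_nonneg_right (hM n x) (abs_nonneg _)
    · filter_upwards [hq] with x hx
      exact hx.mul_const _
  have h2 : Tendsto (fun n => ∫ x, qn n x * (gn n x - g x) ∂μ) atTop (𝓝 0) := by
    refine squeeze_zero_norm (fun n => ?_) (by simpa using hlim.const_mul M)
    rw [← integral_const_mul]
    refine (norm_integral_le_integral_norm _).trans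
      (integral_mono (hb n ((hgn n).sub hg)).norm (((hgn n).sub hg).abs.const_mul M) fun x => ?_)
    simp only [Real.norm_eq_abs, abs_mul]
    exact mul_le_mul_of_nonneg_right (hM n x) (abs_nonneg _)
  have h3 : ∀ n, ∫ x, qn n x * gn n x ∂μ =
      (∫ x, qn n x * g x ∂μ) + ∫ x, qn n x * (gn n x - g x) ∂μ := fun n => by
    have e := integral_add (hb n hg) (hb n ((hgn n).sub hg))
    simp only [Pi.sub_apply] at e
    rw [← e]
    refine integral_congr_ae (Eventually.of_forall fun x => ?_)
    simp only
    ring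
  simp_rw [h3]
  simpa using h1.add h2

theorem locallyIntegrableOn_bdd_mul {Ω : Opens (Euc m)} {q g : Euc m → ℝ} {M : ℝ}
    (hq : AEStronglyMeasurable q (volume.restrict (Ω : Set (Euc m)))) (hM : ∀ x, |q x| ≤ M)
    (hg : LocallyIntegrableOn g (Ω : Set (Euc m)) volume) :
    LocallyIntegrableOn (fun x => q x * g x) (Ω : Set (Euc m)) volume := by
  rw [locallyIntegrableOn_iff (Ω.isOpen.isLocallyClosed)] at hg ⊢
  intro k hk hkc
  exact (hg k hk hkc).bdd_mul (hq.mono_measure (Measure.restrict_mono hk le_rfl))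
    (Eventually.of_forall hM)

theorem locallyIntegrableOn_finset_sum {ι : Type*} (s : Finset ι) {Ω : Opens (Euc m)}
    {g : ι → Euc m → ℝ} (hg : ∀ k ∈ s, LocallyIntegrableOn (g k) (Ω : Set (Euc m)) volume) :
    LocallyIntegrableOn (fun x => ∑ k ∈ s, g k x) (Ω : Set (Euc m)) volume := by
  rw [locallyIntegrableOn_iff (Ω.isOpen.isLocallyClosed)]
  intro K hK hKc
  exact integrable_finsetSum s fun k hk => (hg k hk).integrableOn_compact_subset hK hKc

/-- The chain rule for a bounded `C^1` function with bounded derivative. -/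
theorem hasWeakPartial_comp {Ω : Opens (Euc m)} {i : Fin m} {d : ℕ} {f : Euc d → ℝ}
    (hf : ContDiff ℝ 1 f) {M : ℝ} (hM : ∀ y, |f y| ≤ M)
    (hM' : ∀ k y, |partialDeriv k f y| ≤ M) {θ g : Fin d → Euc m → ℝ}
    (h : ∀ k, HasWeakPartial Ω i (θ k) (g k)) :
    HasWeakPartial Ω i (fun x => f (WithLp.toLp 2 fun k => θ k x))
      (fun x => ∑ k, partialDeriv k f (WithLp.toLp 2 fun k => θ k x) * g k x) := by
  have hpc : ∀ k, Continuous (partialDeriv k f) := fun k =>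
    (hf.continuous_fderiv (by norm_num)).clm_apply continuous_const
  have hΘ : AEStronglyMeasurable (fun x => (WithLp.toLp 2 fun k => θ k x : Euc d))
      (volume.restrict (Ω : Set (Euc m))) :=
    (PiLp.continuous_toLp 2 _).comp_aestronglyMeasurable
      (aemeasurable_pi_lambda _ fun k =>
        (h k).1.aestronglyMeasurable.aemeasurable).aestronglyMeasurable
  have hfl : LocallyIntegrableOn (fun x => f (WithLp.toLp 2 fun k => θ k x))
      (Ω : Set (Euc m)) volume := by
    have := locallyIntegrableOn_bdd_mul (Ω := Ω) (g := fun _ => 1)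
      (hf.continuous.comp_aestronglyMeasurable hΘ) (fun x => hM _)
      ((locallyIntegrable_const 1).locallyIntegrableOn _)
    simpa using this
  have hpl : ∀ k, LocallyIntegrableOn
      (fun x => partialDeriv k f (WithLp.toLp 2 fun k => θ k x) * g k x)
      (Ω : Set (Euc m)) volume := fun k =>
    locallyIntegrableOn_bdd_mul ((hpc k).comp_aestronglyMeasurable hΘ) (fun x => hM' k _) (h k).2.1
  refine ⟨hfl, locallyIntegrableOn_finset_sum _ fun k _ => hpl k, fun φ => ?_⟩
  rw [setIntegral_mul_partialDeriv, setIntegral_mul_test]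
  -- The margin `δ` leaves room for mollifying: once the outer radius is below `δ`, balls centred on
  -- the support of `φ` stay in the thickening.
  obtain ⟨δ, hδ, hδΩ⟩ := φ.hasCompactSupport.isCompact.exists_cthickening_subset_open
    Ω.isOpen φ.tsupport_subset
  set K := Metric.cthickening δ (tsupport φ) with hKdef
  have hK : IsCompact K := φ.hasCompactSupport.isCompact.cthickening
  have hint : ∀ {u : Euc m → ℝ}, LocallyIntegrableOn u (Ω : Set (Euc m)) volume →
      Integrable (K.indicator u) volume := fun hu =>
    (integrable_indicator_iff hK.measurableSet).2 (hu.integrableOn_compact_subset hδΩ hK)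
  have hsub : tsupport φ ⊆ K := Metric.self_subset_cthickening _
  let Θ : ℕ → Euc m → Euc d := fun n x => WithLp.toLp 2 fun k => mollify n (K.indicator (θ k)) x
  have hΘs : ∀ n, ContDiff ℝ 1 (Θ n) := fun n => contDiff_euclidean.2 fun k =>
    (contDiff_mollify n (hint (h k).1).locallyIntegrable).of_le (by exact_mod_cast le_top)
  have hΘlim : ∀ᵐ x, x ∈ tsupport φ →
      Tendsto (fun n => Θ n x) atTop (𝓝 (WithLp.toLp 2 fun k => θ k x)) := by
    filter_upwards [ae_all_iff.2 fun k => ae_tendsto_mollify (hint (h k).1).locallyIntegrable]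
      with x hx hxK
    refine ((PiLp.continuous_toLp 2 _).tendsto _).comp (tendsto_pi_nhds.2 fun k => ?_)
    have := hx k
    rwa [Set.indicator_of_mem (hsub hxK)] at this
  have hderiv : ∀ n x, partialDeriv i (fun x => f (Θ n x)) x =
      ∑ k, partialDeriv k f (Θ n x) * partialDeriv i (mollify n (K.indicator (θ k))) x := by
    intro n x
    have h1 : HasFDerivAt f (fderiv ℝ f (Θ n x)) (Θ n x) :=
      ((hf.differentiable (by norm_num)) _).hasFDerivAt
    have h2 : HasFDerivAt (Θ n) (fderiv ℝ (Θ n) x) x :=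
      (((hΘs n).differentiable (by norm_num)) _).hasFDerivAt
    have h3 : HasFDerivAt (fun x => f (Θ n x)) _ x := h1.comp x h2
    have h4 : ∀ k, (fderiv ℝ (Θ n) x (EuclideanSpace.single i 1)) k =
        partialDeriv i (mollify n (K.indicator (θ k))) x := fun k => by
      have h5 : HasFDerivAt (fun x => Θ n x k) _ x :=
        (EuclideanSpace.proj (𝕜 := ℝ) k).hasFDerivAt.comp x h2
      have h6 : fderiv ℝ (mollify n (K.indicator (θ k))) x = _ := h5.fderiv
      unfold partialDeriv
      rw [h6]
      rfl
    have h7 : fderiv ℝ (Θ n) x (EuclideanSpace.single i 1) =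
        ∑ k, partialDeriv i (mollify n (K.indicator (θ k))) x •
          (EuclideanSpace.single k 1 : Euc d) := by
      ext l
      rw [h4]
      simp [Finset.sum_apply, Pi.single_apply]
    have h8 : partialDeriv i (fun x => f (Θ n x)) x =
        fderiv ℝ f (Θ n x) (fderiv ℝ (Θ n) x (EuclideanSpace.single i 1)) := by
      conv_lhs => unfold partialDeriv
      rw [h3.fderiv]
      rfl
    rw [h8, h7, map_sum]
    refine Finset.sum_congr rfl fun k _ => ?_
    rw [map_smul, smul_eq_mul, mul_comm]
    rfl
  obtain ⟨B, hB⟩ := φ.hasCompactSupport.exists_bound_of_continuous φ.continuous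
  have hM0 : 0 ≤ M := (abs_nonneg _).trans (hM 0)
  have hfc : ∀ n, Continuous fun x => f (Θ n x) := fun n =>
    hf.continuous.comp (hΘs n).continuous
  have hlhs : Tendsto (fun n => ∫ x, f (Θ n x) * partialDeriv i φ x) atTop
      (𝓝 (∫ x, f (WithLp.toLp 2 fun k => θ k x) * partialDeriv i φ x)) := by
    refine tendsto_integral_of_dominated_convergence (fun x => M * |partialDeriv i φ x|)
      (fun n => ((hfc n).mul (testPartial i φ).continuous).aestronglyMeasurable)
      ((integrable_test (testPartial i φ)).abs.const_mul M)
      (fun n => Eventually.of_forall fun x => ?_) ?_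
    · rw [Real.norm_eq_abs, abs_mul]
      exact mul_le_mul_of_nonneg_right (hM _) (abs_nonneg _)
    · filter_upwards [hΘlim] with x hx
      by_cases hxs : x ∈ tsupport φ
      · exact ((hf.continuous.tendsto _).comp (hx hxs)).mul_const _
      · have h0 : partialDeriv i φ x = 0 := by
          have : x ∉ tsupport (testPartial i φ) := fun hh =>
            hxs (tsupport_fderiv_apply_subset ℝ _ hh)
          exact image_eq_zero_of_notMem_tsupport this
        simp [h0]
  -- Keeping `φ` in the bounded factor makes that factor vanish off the support, where `Θ n` need
  -- not converge to `θ`.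
  have hterm : ∀ k, Tendsto
      (fun n => ∫ x, partialDeriv k f (Θ n x) * φ x * mollify n (K.indicator (g k)) x) atTop
      (𝓝 (∫ x, partialDeriv k f (WithLp.toLp 2 fun k => θ k x) * φ x *
        K.indicator (g k) x)) := by
    intro k
    refine tendsto_integral_mul_of_bounded (M := M * B)
      (fun n => (((hpc k).comp (hΘs n).continuous).mul φ.continuous).aestronglyMeasurable)
      (fun n x => ?_) ?_ (hint (h k).2.1) (fun n => integrable_mollify n (hint (h k).2.1))
      (tendsto_integral_abs_mollify_sub (hint (h k).2.1))
    · rw [abs_mul]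
      exact mul_le_mul (hM' k _) (hB x) (abs_nonneg _) hM0
    · filter_upwards [hΘlim] with x hx
      by_cases hxs : x ∈ tsupport φ
      · exact (((hpc k).tendsto _).comp (hx hxs)).mul_const _
      · simp [image_eq_zero_of_notMem_tsupport hxs]
  have hti : ∀ n k, Integrable
      (fun x => partialDeriv k f (Θ n x) * φ x * mollify n (K.indicator (g k)) x) volume := by
    intro n k
    refine (integrable_mollify n (hint (h k).2.1)).bdd_mul (c := M * B)
      (((hpc k).comp (hΘs n).continuous).mul φ.continuous).aestronglyMeasurable
      (Eventually.of_forall fun x => ?_)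
    rw [Real.norm_eq_abs, abs_mul]
    exact mul_le_mul (hM' k _) (hB x) (abs_nonneg _) hM0
  -- For the smooth approximations this is the classical chain rule and integration by parts; the
  -- weak identity is the limit in `n`.
  have hev : ∀ᶠ n in atTop, ∑ k, ∫ x, partialDeriv k f (Θ n x) * φ x *
      mollify n (K.indicator (g k)) x = - ∫ x, f (Θ n x) * partialDeriv i φ x := by
    filter_upwards [(tendsto_moll_rOut m).eventually (gt_mem_nhds hδ)] with n hn
    have hpt : ∀ x, ∑ k, partialDeriv k f (Θ n x) * φ x * mollify n (K.indicator (g k)) x =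
        partialDeriv i (fun x => f (Θ n x)) x * φ x := by
      intro x
      by_cases hxs : x ∈ tsupport φ
      · rw [hderiv, Finset.sum_mul]
        refine Finset.sum_congr rfl fun k _ => ?_
        rw [(h k).partialDeriv_mollify hK hδΩ
          ((Metric.closedBall_subset_closedBall hn.le).trans
            (Metric.closedBall_subset_cthickening hxs δ))]
        ring
      · simp [image_eq_zero_of_notMem_tsupport hxs]
    have hfs : ContDiff ℝ 1 fun x => f (Θ n x) := hf.comp (hΘs n)
    have hcd : Continuous (partialDeriv i fun x => f (Θ n x)) :=
      (hfs.continuous_fderiv (by norm_num)).clm_apply continuous_const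
    rw [← integral_finsetSum _ fun k _ => hti n k, integral_congr_ae (Eventually.of_forall hpt)]
    have hl : ∀ {w : Euc m → ℝ}, Continuous w → LocallyIntegrableOn w (Ω : Set (Euc m)) volume :=
      fun hw => hw.locallyIntegrable.locallyIntegrableOn _
    have := integral_mul_fderiv_eq_neg_fderiv_mul_of_integrable (μ := (volume : Measure (Euc m)))
      (f := fun x => f (Θ n x)) (g := φ) (v := EuclideanSpace.single i 1)
      (integrable_mul_test (hl hcd) φ) (integrable_mul_partialDeriv (hl (hfc n)) i φ)
      (integrable_mul_test (hl (hfc n)) φ)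
      (fun x _ => (hfs.differentiable (by norm_num)) x)
      (fun x _ => (φ.contDiff.differentiable (by simp)) x)
    have e : ∫ x, f (Θ n x) * partialDeriv i φ x =
      - ∫ x, partialDeriv i (fun x => f (Θ n x)) x * φ x := this
    rw [e, neg_neg]
  have hu := tendsto_nhds_unique
    (((tendsto_finsetSum Finset.univ fun k _ => hterm k).congr' hev)) hlhs.neg
  rw [← neg_eq_iff_eq_neg, ← hu, ← integral_finsetSum]
  · refine integral_congr_ae (Eventually.of_forall fun x => ?_)
    simp only
    rw [Finset.sum_mul]
    refine Finset.sum_congr rfl fun k _ => ?_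
    by_cases hxs : x ∈ tsupport φ
    · rw [Set.indicator_of_mem (hsub hxs)]
      ring
    · simp [image_eq_zero_of_notMem_tsupport hxs]
  · intro k _
    refine (integrable_mul_test (hpl k) φ).congr (Eventually.of_forall fun x => ?_)
    by_cases hxs : x ∈ tsupport φ
    · simp only [Set.indicator_of_mem (hsub hxs)]
      ring
    · simp [image_eq_zero_of_notMem_tsupport hxs]

end

section

variable {m : ℕ}

/-! ### Normalized vector fields -/

theorem abs_apply_le_norm (y : Euc m) (k : Fin m) : |y k| ≤ ‖y‖ := by
  simpa using PiLp.norm_apply_le y k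

/-- Apply the product rule to `f z * ‖z‖ = z J`; the derivative of the norm comes from that of its
square. -/
theorem partialDeriv_mul_norm {f : Euc m → ℝ} {J : Fin m} {y : Euc m} (hy : y ≠ 0)
    (hf : DifferentiableAt ℝ f y) (h : ∀ᶠ z in 𝓝 y, f z * ‖z‖ = z J) (k : Fin m) :
    partialDeriv k f y * ‖y‖ = (if k = J then 1 else 0) - y k * y J / ‖y‖ ^ 2 := by
  have hn : DifferentiableAt ℝ (fun z : Euc m => ‖z‖) y :=
    (contDiffAt_norm ℝ hy (n := 1)).differentiableAt (by norm_num)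
  have hy' : ‖y‖ ≠ 0 := norm_ne_zero_iff.2 hy
  have h1 : partialDeriv k (fun z : Euc m => ‖z‖) y = y k / ‖y‖ := by
    have e1 : HasFDerivAt (fun z : Euc m => ‖z‖ ^ 2) _ y :=
      (hasStrictFDerivAt_norm_sq y).hasFDerivAt
    have e2 : HasFDerivAt (fun z : Euc m => ‖z‖ ^ 2) _ y := hn.hasFDerivAt.pow 2
    have e3 := DFunLike.congr_fun (e1.unique e2) (EuclideanSpace.single k 1)
    simp [EuclideanSpace.inner_single_right] at e3
    unfold partialDeriv
    field_simp
    linarith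
  have h2 : HasFDerivAt (fun z => f z * ‖z‖) _ y := hf.hasFDerivAt.mul hn.hasFDerivAt
  have h3 : HasFDerivAt (fun z : Euc m => z J) _ y :=
    (EuclideanSpace.proj (𝕜 := ℝ) J).hasFDerivAt
  have h4 := DFunLike.congr_fun (h2.unique (h3.congr_of_eventuallyEq h))
    (EuclideanSpace.single k 1)
  have h5 : f y * partialDeriv k (fun z : Euc m => ‖z‖) y + ‖y‖ * partialDeriv k f y =
      if k = J then 1 else 0 := by
    simpa [partialDeriv, Pi.single_apply, eq_comm] using h4
  have h6 : f y = y J / ‖y‖ := by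
    rw [eq_div_iff hy']
    exact h.self_of_nhds
  rw [h1, h6] at h5
  rw [← h5]
  field_simp
  ring

/-- A `C^1` modification of `y ↦ y_J / |y|` near the origin. -/
theorem exists_contDiff_normalize {C : ℝ} (hC : 0 < C) (J : Fin m) :
    ∃ (f : Euc m → ℝ) (M : ℝ), ContDiff ℝ 1 f ∧ (∀ y, |f y| ≤ M) ∧
      (∀ k y, |partialDeriv k f y| ≤ M) ∧ ∀ y, C ≤ ‖y‖ → f y = y J / ‖y‖ ∧
        ∀ k, partialDeriv k f y * ‖y‖ = (if k = J then 1 else 0) - y k * y J / ‖y‖ ^ 2 := by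
  -- The outer radius is strictly less than `C`, so `f` agrees with the true quotient on a
  -- neighbourhood of every `y` with `C ≤ ‖y‖`, and so do its derivatives.
  let b : ContDiffBump (0 : Euc m) := ⟨C / 4, C / 2, by positivity, by linarith⟩
  let f : Euc m → ℝ := fun y => (1 - b y) * (y J / ‖y‖)
  have hf : ContDiff ℝ 1 f := by
    rw [contDiff_iff_contDiffAt]
    intro y
    by_cases hy : y = 0
    · subst hy
      have : f =ᶠ[𝓝 0] fun _ => (0 : ℝ) := by
        filter_upwards [b.eventuallyEq_one] with z hz
        simp [f, hz]
      exact contDiffAt_const.congr_of_eventuallyEq this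
    · exact (contDiffAt_const.sub b.contDiffAt).mul
        (((EuclideanSpace.proj (𝕜 := ℝ) J).contDiff.contDiffAt).div (contDiffAt_norm ℝ hy)
          (norm_ne_zero_iff.2 hy))
  have hout : ∀ y, C ≤ ‖y‖ → ∀ᶠ z in 𝓝 y, f z * ‖z‖ = z J := by
    intro y hy
    have ho : IsOpen {z : Euc m | C / 2 < ‖z‖} := isOpen_lt continuous_const continuous_norm
    filter_upwards [ho.mem_nhds (show C / 2 < ‖y‖ by linarith)] with z hz
    have hz' : C / 2 < ‖z‖ := hz
    have h0 : b z = 0 := b.zero_of_le_dist (by rw [dist_zero_right]; exact hz'.le)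
    have : ‖z‖ ≠ 0 := by linarith [half_pos hC]
    simp only [f, h0]
    field_simp
    simp
  have hform : ∀ y, C ≤ ‖y‖ → ∀ k,
      partialDeriv k f y * ‖y‖ = (if k = J then 1 else 0) - y k * y J / ‖y‖ ^ 2 := fun y hy k =>
    partialDeriv_mul_norm (norm_pos_iff.1 (hC.trans_le hy))
      (hf.differentiable (by norm_num) y) (hout y hy) k
  have hb1 : ∀ y, |f y| ≤ 1 := by
    intro y
    have h1 : |1 - b y| ≤ 1 := by
      rw [abs_le]
      constructor <;> linarith [b.nonneg (x := y), b.le_one (x := y)]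
    have h2 : |y J / ‖y‖| ≤ 1 := by
      rw [abs_div, abs_norm]
      exact div_le_one_of_le₀ (abs_apply_le_norm y J) (norm_nonneg _)
    simp only [f, abs_mul]
    exact mul_le_one₀ h1 (abs_nonneg _) h2
  have hfc : Continuous (fderiv ℝ f) := hf.continuous_fderiv (by norm_num)
  obtain ⟨B, hB⟩ := (isCompact_closedBall (0 : Euc m) C).exists_bound_of_continuousOn
    hfc.continuousOn
  -- `1` bounds the values, `B` the derivative on the closed ball of radius `C` by compactness, and
  -- `2 / C` the derivative outside it by the explicit formula.
  refine ⟨f, max 1 (max B (2 / C)), hf, fun y => (hb1 y).trans (le_max_left _ _),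
    fun k y => ?_, fun y hy => ⟨?_, hform y hy⟩⟩
  · refine le_trans ?_ (le_max_right _ _)
    by_cases hy : ‖y‖ ≤ C
    · refine le_trans ?_ (le_max_left _ _)
      refine le_trans ?_ (hB y (by simpa using hy))
      have := (fderiv ℝ f y).le_opNorm (EuclideanSpace.single k 1)
      simpa [partialDeriv] using this
    · refine le_trans ?_ (le_max_right _ _)
      push Not at hy
      have h1 := congrArg abs (hform y hy.le k)
      have hpos : 0 < ‖y‖ := hC.trans hy
      have h2 : |y k * y J / ‖y‖ ^ 2| ≤ 1 := by
        rw [abs_div, abs_mul, abs_of_nonneg (sq_nonneg ‖y‖), sq]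
        exact div_le_one_of_le₀ (mul_le_mul (abs_apply_le_norm y k) (abs_apply_le_norm y J)
          (abs_nonneg _) hpos.le) (by positivity)
      have h3 : |(if k = J then (1 : ℝ) else 0)| ≤ 1 := by split_ifs <;> simp
      rw [abs_mul, abs_norm] at h1
      have h4 := abs_sub (if k = J then (1 : ℝ) else 0) (y k * y J / ‖y‖ ^ 2)
      rw [le_div_iff₀ hC]
      calc |partialDeriv k f y| * C ≤ |partialDeriv k f y| * ‖y‖ := by gcongr
        _ ≤ 2 := by linarith
  · rw [eq_div_iff (hC.trans_le hy).ne']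
    exact (hout y hy).self_of_nhds

/-- The weak derivative of a component of a normalized vector field. -/
theorem exists_hasWeakPartial_normalize {Ω : Opens (Euc m)} {C : ℝ} (hC : 0 < C)
    {θ : Euc m → Euc m} {g : Fin m → Fin m → Euc m → ℝ}
    (h : ∀ I J, HasWeakPartial Ω I (fun x => θ x J) (g I J))
    (hθ : ∀ᵐ x ∂(volume.restrict (Ω : Set (Euc m))), C ≤ ‖θ x‖) (I J : Fin m) :
    ∃ n : Euc m → ℝ, HasWeakPartial Ω I (fun x => θ x J / ‖θ x‖) n ∧
      ∀ᵐ x ∂(volume.restrict (Ω : Set (Euc m))),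
        n x * ‖θ x‖ = g I J x - θ x J / ‖θ x‖ * ∑ k, θ x k / ‖θ x‖ * g I k x := by
  obtain ⟨f, M, hf, hM, hM', hfo⟩ := exists_contDiff_normalize hC J
  refine ⟨_, (hasWeakPartial_comp hf hM hM' (h I)).congr ?_ (ae_eq_refl _), ?_⟩
  · filter_upwards [hθ] with x hx
    exact (hfo _ hx).1
  · filter_upwards [hθ] with x hx
    have hp : ∀ k, partialDeriv k f (WithLp.toLp 2 fun k => θ x k) * ‖θ x‖ = _ := (hfo _ hx).2
    have hpos : ‖θ x‖ ≠ 0 := (hC.trans_le hx).ne'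
    rw [Finset.sum_mul, Finset.mul_sum]
    have : ∀ k, partialDeriv k f (WithLp.toLp 2 fun k => θ x k) * g I k x * ‖θ x‖ =
        (if k = J then g I k x else 0) - θ x J / ‖θ x‖ * (θ x k / ‖θ x‖ * g I k x) := by
      intro k
      rw [mul_right_comm, hp k]
      split_ifs
      · field_simp
      · field_simp
        ring
    simp [this]

/-- The matrix factors through `ℝ²`. -/
theorem rank_sub_vecMulVec_le (a b c d : Fin m → ℝ) :
    (Matrix.vecMulVec a b - Matrix.vecMulVec c d).rank ≤ 2 := by
  have e : Matrix.vecMulVec a b - Matrix.vecMulVec c d =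
      (Matrix.of fun i => ![a i, -c i]) * Matrix.of ![b, d] := by
    ext i j
    simp [Matrix.mul_apply, Matrix.vecMulVec_apply, sub_eq_add_neg]
  rw [e]
  exact (Matrix.rank_mul_le_left _ _).trans (Matrix.rank_le_width _)

/-- Two vector fields which are positive multiples of each other and have the same curl of rank
at least three have the same length. -/
theorem ae_norm_eq_of_curl_eq {Ω : Opens (Euc m)} {C : ℝ} (hC : 0 < C)
    {θ θ' : Euc m → Euc m} {g g' : Fin m → Fin m → Euc m → ℝ}
    (h : ∀ I J, HasWeakPartial Ω I (fun x => θ x J) (g I J))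
    (h' : ∀ I J, HasWeakPartial Ω I (fun x => θ' x J) (g' I J))
    (hθ : ∀ᵐ x ∂(volume.restrict (Ω : Set (Euc m))), C ≤ ‖θ x‖)
    (hθ' : ∀ᵐ x ∂(volume.restrict (Ω : Set (Euc m))), C ≤ ‖θ' x‖)
    (hdir : ∀ᵐ x ∂(volume.restrict (Ω : Set (Euc m))), ∀ J, θ x J / ‖θ x‖ = θ' x J / ‖θ' x‖)
    {A : Euc m → Matrix (Fin m) (Fin m) ℝ}
    (hA : ∀ᵐ x ∂(volume.restrict (Ω : Set (Euc m))), ∀ I J, A x I J = g I J x - g J I x)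
    (hA' : ∀ᵐ x ∂(volume.restrict (Ω : Set (Euc m))), ∀ I J, A x I J = g' I J x - g' J I x)
    (hrank : ∀ᵐ x ∂(volume.restrict (Ω : Set (Euc m))), 3 ≤ (A x).rank) :
    ∀ᵐ x ∂(volume.restrict (Ω : Set (Euc m))), ‖θ x‖ = ‖θ' x‖ := by
  choose n hn hne using exists_hasWeakPartial_normalize hC h hθ
  choose n' hn' hne' using exists_hasWeakPartial_normalize hC h' hθ'
  -- Both are weak derivatives of the same component of the common direction.
  have heq : ∀ I J, n I J =ᵐ[volume.restrict (Ω : Set (Euc m))] n' I J := fun I J =>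
    (hn I J).ae_unique ((hn' I J).congr
      (by filter_upwards [hdir] with x hx using (hx J).symm) (ae_eq_refl _))
  have all := fun {P : Fin m → Fin m → Euc m → Prop}
    (hP : ∀ I J, ∀ᵐ x ∂(volume.restrict (Ω : Set (Euc m))), P I J x) =>
      ae_all_iff.2 fun I => ae_all_iff.2 (hP I)
  filter_upwards [all hne, all hne', all heq, hdir, hA, hA', hrank]
    with x h1 h2 h3 h4 h5 h6 h7
  by_contra hpq
  set p := ‖θ x‖
  set q := ‖θ' x‖
  have hd : q - p ≠ 0 := sub_ne_zero.2 (Ne.symm hpq)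
  set N : Fin m → ℝ := fun J => θ x J / p with hN
  set c : Fin m → ℝ := fun I => q * ∑ k, θ x k / p * g I k x - p * ∑ k, θ x k / p * g' I k x
    with hc
  have key : ∀ I J, q * g I J x - p * g' I J x = N J * c I := by
    intro I J
    have e1 := h1 I J
    have e2 := h2 I J
    simp only [← h4, ← h3 I J] at e2
    simp only [hN, hc]
    linear_combination q * (-e1) + p * e2
  -- Antisymmetrize `key` in `I`, `J`; as both curls are `A x`, the left side becomes `(q - p) • A
  -- x`.
  have hmat : A x = Matrix.vecMulVec ((q - p)⁻¹ • c) N - Matrix.vecMulVec N ((q - p)⁻¹ • c) := by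
    ext I J
    have k1 := key I J
    have k2 := key J I
    have k3 := h5 I J
    have k4 := h6 I J
    simp only [Matrix.sub_apply, Matrix.vecMulVec_apply, Pi.smul_apply, smul_eq_mul]
    field_simp
    linear_combination q * k3 - p * k4 + k1 - k2
  rw [hmat] at h7
  have := rank_sub_vecMulVec_le ((q - p)⁻¹ • c) N N ((q - p)⁻¹ • c)
  omega

end

section

variable {m : ℕ} {Ω : Opens (Euc m)}

/-! ### The Poincaré inequality -/

theorem norm_fderiv_le_sum (f : Euc m → ℝ) (x : Euc m) :
    ‖fderiv ℝ f x‖ ≤ ∑ i, |partialDeriv i f x| := by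
  refine ContinuousLinearMap.opNorm_le_bound _ (Finset.sum_nonneg fun i _ => abs_nonneg _)
    fun v => ?_
  have hv : v = ∑ i, v i • (EuclideanSpace.single i 1 : Euc m) := by
    ext l
    simp [Finset.sum_apply, Pi.single_apply]
  have e : fderiv ℝ f x v = ∑ i, v i * partialDeriv i f x := by
    conv_lhs => rw [hv, map_sum]
    simp [partialDeriv]
  rw [e, Real.norm_eq_abs, Finset.sum_mul]
  refine (Finset.abs_sum_le_sum_abs _ _).trans (Finset.sum_le_sum fun i _ => ?_)
  rw [abs_mul, mul_comm]
  gcongr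
  simpa using PiLp.norm_apply_le v i

/-- The Sobolev inequality on a bounded set with both exponents equal to `1`, which must be less
than the dimension; hence `1 < m`. -/
theorem exists_integral_abs_test_le (hΩ : Bornology.IsBounded (Ω : Set (Euc m))) (hm : 1 < m) :
    ∃ c : ℝ, 0 ≤ c ∧ ∀ φ : 𝓓(Ω, ℝ), ∫ x in (Ω : Set (Euc m)), |φ x| ≤
      c * ∑ i : Fin m, ∫ x in (Ω : Set (Euc m)), |partialDeriv i φ x| := by
  refine ⟨eLpNormLESNormFDerivOfLeConst ℝ (volume : Measure (Euc m)) (Ω : Set (Euc m)) 1 1,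
    NNReal.coe_nonneg _, fun φ => ?_⟩
  have hres : ∀ ψ : 𝓓(Ω, ℝ), ∫ x in (Ω : Set (Euc m)), |ψ x| = ∫ x, |ψ x| := fun ψ =>
    setIntegral_eq_integral_of_forall_compl_eq_zero fun x hx => by
      rw [image_eq_zero_of_notMem_tsupport fun h => hx (ψ.tsupport_subset h), abs_zero]
  have h := eLpNorm_le_eLpNorm_fderiv (volume : Measure (Euc m)) (u := φ)
    (s := (Ω : Set (Euc m))) (φ.contDiff.of_le (by exact_mod_cast le_top))
    ((subset_tsupport _).trans φ.tsupport_subset) (p := 1) le_rfl (by simpa using hm) hΩ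
  have hfi : Integrable (fderiv ℝ φ) volume :=
    (φ.contDiff.continuous_fderiv (by simp)).integrable_of_hasCompactSupport
      (φ.hasCompactSupport.fderiv (𝕜 := ℝ))
  rw [ENNReal.coe_one, eLpNorm_one_eq_lintegral_enorm, eLpNorm_one_eq_lintegral_enorm,
    ← ofReal_integral_norm_eq_lintegral_enorm (integrable_test φ),
    ← ofReal_integral_norm_eq_lintegral_enorm hfi, ← ENNReal.ofReal_coe_nnreal,
    ← ENNReal.ofReal_mul (NNReal.coe_nonneg _), ENNReal.ofReal_le_ofReal_iff
      (mul_nonneg (NNReal.coe_nonneg _) (integral_nonneg fun x => norm_nonneg _))] at h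
  rw [hres φ]
  refine h.trans (mul_le_mul_of_nonneg_left ?_ (NNReal.coe_nonneg _))
  have e : ∀ i, ∫ x in (Ω : Set (Euc m)), |partialDeriv i φ x| = ∫ x, |partialDeriv i φ x| :=
    fun i => hres (testPartial i φ)
  simp_rw [e]
  have hi : ∀ i ∈ Finset.univ, Integrable (fun x => |partialDeriv i φ x|) volume := fun i _ =>
    (integrable_test (testPartial i φ)).abs
  rw [← integral_finsetSum _ hi]
  exact integral_mono hfi.norm (integrable_finsetSum _ hi) (norm_fderiv_le_sum φ)

/-- A function in `W_0^{1,1}` of a bounded open set with vanishing weak gradient vanishes. -/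
theorem MemW011.ae_eq_zero (hΩ : Bornology.IsBounded (Ω : Set (Euc m))) (hm : 1 < m)
    {w : Euc m → ℝ} (hw : MemW011 Ω w)
    (h0 : ∀ i, weakPartial Ω i w =ᵐ[volume.restrict (Ω : Set (Euc m))] 0) :
    w =ᵐ[volume.restrict (Ω : Set (Euc m))] 0 := by
  obtain ⟨c, hc, hP⟩ := exists_integral_abs_test_le hΩ hm
  have hle : ∀ ε : ℝ, 0 < ε → ∫ x in (Ω : Set (Euc m)), |w x| ≤ (1 + c) * ε := by
    intro ε hε
    obtain ⟨φ, hφ⟩ := hw.2 ε hε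
    -- As `∇w = 0`, closeness of `φ` to `w` makes the gradient of `φ` small, hence `φ` itself by
    -- Poincaré.
    have hpart : ∀ i, ∫ x in (Ω : Set (Euc m)), |weakPartial Ω i (fun x => w x - φ x) x| =
        ∫ x in (Ω : Set (Euc m)), |partialDeriv i φ x| := by
      intro i
      refine integral_congr_ae ?_
      filter_upwards [((hw.1.hasWeakPartial i).sub (hasWeakPartial_test φ i)).ae_eq_weakPartial,
        h0 i] with x hx hx0
      rw [← hx, hx0, Pi.zero_apply, zero_sub, abs_neg]
    unfold normW11 at hφ
    simp_rw [hpart] at hφ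
    have h1 : 0 ≤ ∫ x in (Ω : Set (Euc m)), |w x - φ x| := integral_nonneg fun x => abs_nonneg _
    have h2 : 0 ≤ ∑ i : Fin m, ∫ x in (Ω : Set (Euc m)), |partialDeriv i φ x| :=
      Finset.sum_nonneg fun i _ => integral_nonneg fun x => abs_nonneg _
    have hi1 : Integrable (fun x => |w x - φ x|) (volume.restrict (Ω : Set (Euc m))) :=
      (hw.1.2.1.sub (integrable_test φ).integrableOn).abs
    have hi2 : Integrable (fun x => |φ x|) (volume.restrict (Ω : Set (Euc m))) :=
      (integrable_test φ).integrableOn.abs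
    calc ∫ x in (Ω : Set (Euc m)), |w x|
        ≤ ∫ x in (Ω : Set (Euc m)), (|w x - φ x| + |φ x|) :=
          integral_mono hw.1.2.1.abs (hi1.add hi2) fun x => by
            simpa using abs_add_le (w x - φ x) (φ x)
      _ = (∫ x in (Ω : Set (Euc m)), |w x - φ x|) + ∫ x in (Ω : Set (Euc m)), |φ x| :=
          integral_add hi1 hi2
      _ ≤ ε + c * ε := by
          refine add_le_add (by linarith) ((hP φ).trans ?_)
          exact mul_le_mul_of_nonneg_left (by linarith) hc
      _ = (1 + c) * ε := by ring
  have hz : ∫ x in (Ω : Set (Euc m)), |w x| = 0 := by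
    refine le_antisymm (le_of_forall_pos_le_add fun ε hε => ?_)
      (integral_nonneg fun x => abs_nonneg _)
    have := hle (ε / (1 + c)) (by positivity)
    rw [mul_div_cancel₀ _ (by positivity)] at this
    linarith
  have := (integral_eq_zero_iff_of_nonneg (fun x => abs_nonneg _) hw.1.2.1.abs).1 hz
  filter_upwards [this] with x hx
  simpa using hx

/-! ### Consequences of convexity -/

theorem MemW11.integrable_weakGrad {u : Euc m → ℝ} (hu : MemW11 Ω u) :
    Integrable (weakGrad Ω u) (volume.restrict (Ω : Set (Euc m))) :=
  Integrable.of_eval_piLp fun i => hu.2.2 i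

theorem MemW11.integrable_pArea {F : Euc m → Euc m} {H u : Euc m → ℝ}
    (hF : IntegrableOn F (Ω : Set (Euc m)) volume)
    (hH : MemLp H ∞ (volume.restrict (Ω : Set (Euc m)))) (hu : MemW11 Ω u) :
    Integrable (fun x => ‖weakGrad Ω u x + F x‖ + H x * u x)
      (volume.restrict (Ω : Set (Euc m))) :=
  (hu.integrable_weakGrad.add hF).norm.add (Integrable.mul_of_top_right hu.2.1 hH)

/-- Minimizers with the same boundary values have weak gradients pointing, after translation by
`F`, in the same direction. -/
theorem IsMinimizer.ae_sameRay {F : Euc m → Euc m} {H u v : Euc m → ℝ}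
    (hF : IntegrableOn F (Ω : Set (Euc m)) volume)
    (hH : MemLp H ∞ (volume.restrict (Ω : Set (Euc m))))
    (hu : IsMinimizer Ω F H u) (hv : IsMinimizer Ω F H v)
    (huv : MemW011 Ω (fun x => u x - v x)) :
    ∀ᵐ x ∂(volume.restrict (Ω : Set (Euc m))),
      SameRay ℝ (weakGrad Ω u x + F x) (weakGrad Ω v x + F x) := by
  set z : Euc m → ℝ := fun x => (1 / 2) * (u x + v x) with hz
  have e1 : (fun x => u x + (-(1 / 2)) * (u x - v x)) = z := by
    ext x
    simp only [hz]
    ring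
  have e2 : (fun x => v x + (1 / 2) * (u x - v x)) = z := by
    ext x
    simp only [hz]
    ring
  have h1 := hu.2 _ (huv.const_mul (-(1 / 2)))
  have h2 := hv.2 _ (huv.const_mul (1 / 2))
  rw [e1] at h1
  rw [e2] at h2
  have hzm : MemW11 Ω z := (hu.1.add hv.1).const_mul _
  have hgrad : ∀ᵐ x ∂(volume.restrict (Ω : Set (Euc m))),
      weakGrad Ω z x + F x =
        (1 / 2 : ℝ) • ((weakGrad Ω u x + F x) + (weakGrad Ω v x + F x)) := by
    have : ∀ᵐ x ∂(volume.restrict (Ω : Set (Euc m))), ∀ i,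
        1 / 2 * (weakPartial Ω i u x + weakPartial Ω i v x) = weakPartial Ω i z x :=
      ae_all_iff.2 fun i =>
        (((hu.1.hasWeakPartial i).add (hv.1.hasWeakPartial i)).const_mul (1 / 2)).ae_eq_weakPartial
    filter_upwards [this] with x hx
    ext i
    simp only [weakGrad, PiLp.add_apply, PiLp.smul_apply, smul_eq_mul, ← hx]
    ring
  -- The convexity defect: the `H` terms are linear and cancel. It is nonnegative, while minimality
  -- makes its integral nonpositive.
  set D : Euc m → ℝ := fun x => ‖weakGrad Ω u x + F x‖ + ‖weakGrad Ω v x + F x‖ -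
    ‖(weakGrad Ω u x + F x) + (weakGrad Ω v x + F x)‖ with hD
  have iu := hu.1.integrable_pArea hF hH
  have iv := hv.1.integrable_pArea hF hH
  have iz := hzm.integrable_pArea hF hH
  have hDae : (fun x => (‖weakGrad Ω u x + F x‖ + H x * u x) +
      (‖weakGrad Ω v x + F x‖ + H x * v x) - 2 * (‖weakGrad Ω z x + F x‖ + H x * z x))
      =ᵐ[volume.restrict (Ω : Set (Euc m))] D := by
    filter_upwards [hgrad] with x hx
    rw [hx, norm_smul]
    simp only [hD, hz]
    norm_num
    ring
  have hDi : Integrable D (volume.restrict (Ω : Set (Euc m))) :=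
    ((iu.add iv).sub (iz.const_mul 2)).congr hDae
  have hD0 : 0 ≤ D := fun x => sub_nonneg.2 (norm_add_le _ _)
  have hDint : ∫ x in (Ω : Set (Euc m)), D x =
      pArea Ω F H u + pArea Ω F H v - 2 * pArea Ω F H z := by
    rw [← integral_congr_ae hDae]
    unfold pArea
    rw [← integral_const_mul, ← integral_add iu iv]
    exact integral_sub (iu.add iv) (iz.const_mul 2)
  have hzero : ∫ x in (Ω : Set (Euc m)), D x = 0 :=
    le_antisymm (by rw [hDint]; linarith) (integral_nonneg hD0)
  filter_upwards [(integral_eq_zero_iff_of_nonneg hD0 hDi).1 hzero] with x hx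
  -- Strict convexity of the Euclidean norm: equality in the triangle inequality means a common ray.
  rw [sameRay_iff_norm_add]
  simp only [hD, Pi.zero_apply] at hx
  linarith

end

section

variable {m : ℕ} {Ω : Opens (Euc m)}

/-! ### Uniqueness -/

theorem hasWeakPartial_weakGrad_add {F : Euc m → Euc m} {u : Euc m → ℝ} (hu : MemW21 Ω u)
    (hF : ∀ J : Fin m, MemW1 Ω (fun x => F x J)) (I J : Fin m) :
    HasWeakPartial Ω I (fun x => (weakGrad Ω u x + F x) J)
      (fun x => weakPartial Ω I (weakPartial Ω J u) x + weakPartial Ω I (fun y => F y J) x) :=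
  ((hu.2 J).hasWeakPartial I).add ((hF J).hasWeakPartial I)

/-- The curl of `∇u + F` is the curl of `F`. -/
theorem ae_curlMatrix_eq {F : Euc m → Euc m} {u : Euc m → ℝ} (hu : MemW21 Ω u) :
    ∀ᵐ x ∂(volume.restrict (Ω : Set (Euc m))), ∀ I J, curlMatrix Ω F x I J =
      (weakPartial Ω I (weakPartial Ω J u) x + weakPartial Ω I (fun y => F y J) x) -
      (weakPartial Ω J (weakPartial Ω I u) x + weakPartial Ω J (fun y => F y I) x) := by
  refine ae_all_iff.2 fun I => ae_all_iff.2 fun J => ?_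
  have h : HasWeakPartial Ω J (weakPartial Ω I u) (weakPartial Ω I (weakPartial Ω J u)) :=
    (hu.1.hasWeakPartial I).comm (hu.1.hasWeakPartial J) ((hu.2 J).hasWeakPartial I)
  filter_upwards [h.ae_eq_weakPartial] with x hx
  rw [← hx, curlMatrix, Matrix.of_apply]
  ring

end

end PArea

end

theorem mainTheorem9 (m : ℕ) (Ω : Opens (PArea.Euc m))
    (hΩc : IsConnected (Ω : Set (PArea.Euc m)))
    (hΩb : Bornology.IsBounded (Ω : Set (PArea.Euc m)))
    (F : PArea.Euc m → PArea.Euc m)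
    (hF1 : IntegrableOn F (Ω : Set (PArea.Euc m)) volume)
    (hFW : ∀ J : Fin m, PArea.MemW1 Ω (fun x => F x J))
    (H : PArea.Euc m → ℝ)
    (hH : MemLp H ∞ (volume.restrict (Ω : Set (PArea.Euc m))))
    (u v : PArea.Euc m → ℝ)
    (hu : PArea.MemW21 Ω u) (hv : PArea.MemW21 Ω v)
    (humin : PArea.IsMinimizer Ω F H u) (hvmin : PArea.IsMinimizer Ω F H v)
    (huv : PArea.MemW021 Ω (fun x => u x - v x))
    (C : ℝ) (hC : 0 < C)
    (huC : ∀ᵐ x ∂(volume.restrict (Ω : Set (PArea.Euc m))), C ≤ ‖PArea.weakGrad Ω u x + F x‖)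
    (hvC : ∀ᵐ x ∂(volume.restrict (Ω : Set (PArea.Euc m))), C ≤ ‖PArea.weakGrad Ω v x + F x‖)
    (hrank : ∀ᵐ x ∂(volume.restrict (Ω : Set (PArea.Euc m))),
      3 ≤ (PArea.curlMatrix Ω F x).rank ∧ (PArea.curlMatrix Ω F x).rank ≤ m) :
    u =ᵐ[volume.restrict (Ω : Set (PArea.Euc m))] v := by
  by_cases hm : 1 < m
  swap
  -- For `m ≤ 1` the rank bounds are contradictory, so the claim holds vacuously at almost every
  -- point.
  · filter_upwards [hrank] with x hx
    omega
  have hray : ∀ᵐ x ∂(volume.restrict (Ω : Set (PArea.Euc m))),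
      ‖PArea.weakGrad Ω u x + F x‖⁻¹ • (PArea.weakGrad Ω u x + F x) =
        ‖PArea.weakGrad Ω v x + F x‖⁻¹ • (PArea.weakGrad Ω v x + F x) := by
    filter_upwards [humin.ae_sameRay hF1 hH hvmin huv.memW011, huC, hvC] with x hx hxu hxv
    exact (sameRay_iff_inv_norm_smul_eq_of_ne (norm_pos_iff.1 (hC.trans_le hxu))
      (norm_pos_iff.1 (hC.trans_le hxv))).1 hx
  have hnorm := PArea.ae_norm_eq_of_curl_eq hC
    (fun I J => PArea.hasWeakPartial_weakGrad_add hu hFW I J)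
    (fun I J => PArea.hasWeakPartial_weakGrad_add hv hFW I J) huC hvC
    (by
      filter_upwards [hray] with x hx J
      simpa [div_eq_inv_mul, mul_add] using congrArg (fun y : PArea.Euc m => y J) hx)
    (PArea.ae_curlMatrix_eq hu) (PArea.ae_curlMatrix_eq hv) (hrank.mono fun x hx => hx.1)
  have hgrad : ∀ i, PArea.weakPartial Ω i (fun x => u x - v x)
      =ᵐ[volume.restrict (Ω : Set (PArea.Euc m))] 0 := by
    intro i
    filter_upwards [hray, hnorm, huC,
      ((hu.1.hasWeakPartial i).sub (hv.1.hasWeakPartial i)).ae_eq_weakPartial] with x h1 h2 h3 h4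
    rw [← h2] at h1
    -- Equal directions and equal lengths give equal vectors; `F` then cancels.
    have h5 := smul_right_injective _ (inv_ne_zero (hC.trans_le h3).ne') h1
    have h6 : PArea.weakPartial Ω i u x = PArea.weakPartial Ω i v x :=
      congrArg (fun y : PArea.Euc m => y i) (add_right_cancel h5)
    rw [← h4, h6, sub_self, Pi.zero_apply]
  filter_upwards [huv.memW011.ae_eq_zero hΩb hm hgrad] with x hx
  exact sub_eq_zero.1 hx
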